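/- All spaces have complex scalars. Let $\ell_1(\mathbb Z)$ carry the convolution product and let $\langle x,a\rangle=\sum_{n}x(n)a(n)$ for $x\in\ell_\infty(\mathbb Z)$, $a\in\ell_1(\mathbb Z)$. A *shift-invariant predual* of $\ell_1(\mathbb Z)$ is a closed subspace $E\subseteq\ell_\infty(\mathbb Z)$ such that $\sigma(E)=E$ for the bilateral shift $(\sigma x)(n)=x(n-1)$, and such that the map $\iota_E:\ell_1(\mathbb Z)\to E^*$, $\langle\iota_E(a),x\rangle=\langle x,a\rangle$, is a (not necessarily isometric) isomorphism of Banach spaces. A *semitopological semigroup compactification* of $\mathbb Z$ is a compact Hausdorff space $S$ with an associative, separately continuous operation $+$, together with an injective semigroup homomorphism $\mathbb Z\to S$ with dense range (which need not be a homeomorphism onto its image); we regard $\mathbb Z\subseteq S$. Let $M(S)=C(S)^*$ be the space of regular complex Borel measures on $S$, with the convolution $$\langle\Phi*\Psi,f\rangle=\int_S\Big(\int_S f(s+t)\,d\Phi(s)\Big)d\Psi(t)\qquad(\Phi,\Psi\in M(S),\ f\in C(S)).$$ Let $\delta_s\in M(S)$ be the point mass at $s$, and regard $\ell_1(\mathbb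 Z)\subseteq M(S)$ via $a\mapsto\sum_n a(n)\delta_n$. A *bounded projection* $\Theta:M(S)\to\ell_1(\mathbb Z)$ is a bounded linear map with $\Theta(a)=a$ for all $a\in\ell_1(\mathbb Z)$. Put $${}^\perp\ker\Theta=\{f\in C(S):\langle\Psi,f\rangle=0\text{ for all }\Psi\in\ker\Theta\}.$$ **Theorem 4.1.** 1. Let $S$ be a semitopological semigroup compactification of $\mathbb Z$ and let $\Theta:M(S)\to\ell_1(\mathbb Z)$ be a bounded projection that is a homomorphism with respect to convolution. If $\ker\Theta$ is weak*-closed in $M(S)=C(S)^*$, then $\{f|_{\mathbb Z}:f\in{}^\perp\ker\Theta\}\subseteq\ell_\infty(\mathbb Z)$ is a shift-invariant predual of $\ell_1(\mathbb Z)$. 2. Conversely, if $E\subseteq\ell_\infty(\mathbb Z)$ is a shift-invariant predual of $\ell_1(\mathbb Z)$, then there exist a semitopological semigroup compactification $S$ of $\mathbb Z$ and a bounded projection $\Theta:M(S)\to\ell_1(\mathbb Z)$ that is a homomorphism with respect to convolution, such that $\ker\Theta$ is weak*-closed in $M(S)$ and $E=\{f|_{\mathbb Z}:f\in{}^\perp\ker\Theta\}$.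 Moreover, $S$ and $\Theta$ can be chosen so that the map $S\to\ell_1(\mathbb Z)$, $s\mapsto\Theta(\delta_s)$, is injective. -/

import Mathlib

universe u

noncomputable section

open scoped ENNReal NNReal Topology
open Filter MeasureTheory

namespace ShiftPredual

/-! ### Sequence spaces on the integers -/

/-- The complex Banach space `ℓ₁(ℤ)`. -/
abbrev L1 : Type := lp (fun _ : ℤ => ℂ) 1

/-- The complex Banach space `ℓ_∞(ℤ)`. -/
abbrev Linf : Type := lp (fun _ : ℤ => ℂ) ∞

/-- The duality `⟨x, a⟩ = ∑ₙ x(n) a(n)` between `ℓ_∞(ℤ)` and `ℓ₁(ℤ)`. -/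
def pairing : Linf →L[ℂ] L1 →L[ℂ] ℂ :=
  lp.dualPairing ∞ 1 (fun _ : ℤ => ContinuousLinearMap.mul ℂ ℂ) (K := 1)
    (fun _ => ContinuousLinearMap.opNorm_mul_le ℂ ℂ)

theorem pairing_apply (x : Linf) (a : L1) : pairing x a = ∑' n : ℤ, x n * a n := rfl

theorem summable_conv_prod (a b : L1) :
    Summable fun p : ℤ × ℤ => ‖a p.2 * b (p.1 - p.2)‖ := by
  have ha : Summable fun n : ℤ => ‖a n‖ := by
    simpa using (lp.memℓp a).summable (by simp)
  have hb : Summable fun n : ℤ => ‖b n‖ := by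
    simpa using (lp.memℓp b).summable (by simp)
  let e : ℤ × ℤ ≃ ℤ × ℤ :=
    { toFun := fun p => (p.2, p.1 - p.2)
      invFun := fun q => (q.1 + q.2, q.1)
      left_inv := fun p => by simp
      right_inv := fun q => by simp }
  have h := (e.summable_iff (f := fun q : ℤ × ℤ => ‖a q.1‖ * ‖b q.2‖)).2
    (ha.mul_of_nonneg hb (fun _ => norm_nonneg _) (fun _ => norm_nonneg _))
  simpa [e, Function.comp_def] using h

/-- The convolution product `(a * b)(n) = ∑ₘ a(m) b(n - m)` on `ℓ₁(ℤ)`. -/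
def l1Conv (a b : L1) : L1 :=
  ⟨fun n => ∑' m : ℤ, a m * b (n - m), by
    have h := summable_conv_prod a b
    refine memℓp_gen ?_
    simp only [ENNReal.toReal_one, Real.rpow_one]
    exact Summable.of_nonneg_of_le (fun _ => norm_nonneg _)
      (fun n => norm_tsum_le_tsum_norm (h.prod_factor n)) h.prod⟩

/-- The bilateral shift `(σ x)(n) = x(n - 1)` on `ℓ_∞(ℤ)`. -/
def shift (x : Linf) : Linf :=
  ⟨fun n => x (n - 1), by
    refine memℓp_infty ⟨‖x‖, ?_⟩
    rintro _ ⟨n, rfl⟩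
    exact lp.norm_apply_le_norm (by simp) x (n - 1)⟩

/-- For a subspace `F` of `ℓ_∞(ℤ)`, the canonical map `ι_F : ℓ₁(ℤ) → F*`,
`⟨ι_F(a), x⟩ = ⟨x, a⟩`. -/
def iota (F : Submodule ℂ Linf) : L1 →L[ℂ] StrongDual ℂ F :=
  (pairing.comp F.subtypeL).flip

theorem iota_apply (F : Submodule ℂ Linf) (a : L1) (x : F) :
    iota F a x = ∑' n : ℤ, (x : Linf) n * a n := rfl

/-- A concrete predual of `ℓ₁(ℤ)`: a closed subspace `F` of `ℓ_∞(ℤ)` for which the canonical map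
`ι_F : ℓ₁(ℤ) → F*` is a (not necessarily isometric) isomorphism of Banach spaces. -/
structure IsConcretePredual (F : Submodule ℂ Linf) : Prop where
  isClosed : IsClosed (F : Set Linf)
  isInvertible : (iota F).IsInvertible

/-- A shift-invariant predual of `ℓ₁(ℤ)`: a concrete predual `F` with `σ(F) = F`, `σ` being the
bilateral shift. -/
structure IsShiftInvariantPredual (F : Submodule ℂ Linf) : Prop extends IsConcretePredual F where
  shift_mem_iff : ∀ x : Linf, shift x ∈ F ↔ x ∈ F

/-! ### Semigroup compactifications of the integers -/

/-- A semitopological semigroup compactification of `ℤ`: a compact Hausdorff space that is a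
semigroup with separately continuous addition, together with an injective semigroup homomorphism
from `ℤ` with dense range. (The image of `ℤ` need not be discrete.) -/
structure SemigroupCompactification where
  carrier : Type u
  [topologicalSpace : TopologicalSpace carrier]
  [compactSpace : CompactSpace carrier]
  [t2Space : T2Space carrier]
  [addSemigroup : AddSemigroup carrier]
  [separatelyContinuousAdd : SeparatelyContinuousAdd carrier]
  /-- the embedding of the integers -/
  emb : AddHom ℤ carrier
  emb_injective : Function.Injective emb
  emb_denseRange : DenseRange emb

attribute [instance] SemigroupCompactification.topologicalSpace
  SemigroupCompactification.compactSpace SemigroupCompactification.t2Space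
  SemigroupCompactification.addSemigroup SemigroupCompactification.separatelyContinuousAdd

/-- The space `M(S) = C(S)*` of regular complex Borel measures on the compact Hausdorff space `S`,
as the Banach dual of `C(S)`; the integral `∫ f dΦ` is `Φ f`. -/
abbrev M (S : Type*) [TopologicalSpace S] [CompactSpace S] : Type _ := StrongDual ℂ C(S, ℂ)

/-- The point mass `δ_s`, as the functional `f ↦ f(s)`. -/
def dirac {S : Type*} [TopologicalSpace S] [CompactSpace S] (s : S) : M S :=
  ContinuousMap.evalCLM ℂ s

/-! ### Convolution of measures

For `Φ, Ψ ∈ M(S)` the convolution is `⟨Φ * Ψ, f⟩ = ∫ (∫ f(s + t) dΦ(s)) dΨ(t)`. The two helper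
facts below show that the inner integral is a continuous function of `t`, so that the formula makes
sense for `Φ` and `Ψ` in the dual of `C(S)`. -/

/-- A bounded functional on `C(K)` is dominated by integration against a finite positive
measure. -/
theorem exists_dominating_measure {K : Type*} [TopologicalSpace K] [CompactSpace K] [T2Space K]
    [MeasurableSpace K] [BorelSpace K] (Ψ : StrongDual ℂ C(K, ℂ)) :
    ∃ μ : Measure K, IsFiniteMeasure μ ∧ ∀ g : C(K, ℂ), ‖Ψ g‖ ≤ ∫ x, ‖g x‖ ∂μ := by
  classical
  have hn : ∀ r : ℝ≥0, ‖(r : ℂ)‖₊ = r := fun r => NNReal.eq (by simp)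
  let A : (K → ℝ≥0) → Set ℝ≥0 := fun f => {r | ∃ g : C(K, ℂ), (∀ x, ‖g x‖₊ ≤ f x) ∧ r = ‖Ψ g‖₊}
  let P : (K → ℝ≥0) → ℝ≥0 := fun f => sSup (A f)
  have hbdd : ∀ f : K → ℝ≥0, Continuous f → BddAbove (A f) := by
    intro f hf
    obtain ⟨C, hC⟩ := (isCompact_range hf).bddAbove
    refine ⟨‖Ψ‖₊ * C, ?_⟩
    rintro r ⟨g, hg, rfl⟩
    refine (Ψ.le_opNNNorm g).trans ?_
    gcongr
    have : ‖g‖ ≤ (C : ℝ) := (ContinuousMap.norm_le _ C.2).2 fun x => by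
      exact_mod_cast (hg x).trans (hC ⟨x, rfl⟩)
    exact_mod_cast this
  have hne : ∀ f, (A f).Nonempty := fun f => ⟨_, 0, by simp, rfl⟩
  have hle : ∀ f : K → ℝ≥0, Continuous f → ∀ g : C(K, ℂ), (∀ x, ‖g x‖₊ ≤ f x) → ‖Ψ g‖₊ ≤ P f :=
    fun f hf g hg => le_csSup (hbdd f hf) ⟨g, hg, rfl⟩
  have hphase : ∀ g : C(K, ℂ), ∃ c : ℂ, ‖c‖₊ = 1 ∧ Ψ (c • g) = (‖Ψ g‖ : ℂ) := by
    intro g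
    by_cases h0 : Ψ g = 0
    · exact ⟨1, by simp, by simp [h0]⟩
    · have h1 : (‖Ψ g‖ : ℂ) ≠ 0 := by simpa using h0
      refine ⟨‖Ψ g‖ / Ψ g, ?_, ?_⟩
      · apply NNReal.eq
        simp [h0]
      · rw [map_smul, smul_eq_mul, div_mul_cancel₀ _ h0]
  have hadd : ∀ f₁ f₂ : K → ℝ≥0, Continuous f₁ → Continuous f₂ → P (f₁ + f₂) = P f₁ + P f₂ := by
    intro f₁ f₂ h₁ h₂
    apply le_antisymm
    · refine csSup_le (hne _) ?_
      rintro r ⟨g, hg, rfl⟩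
      have hcont : Continuous fun x => g x * ((f₁ x / (f₁ x + f₂ x) : ℝ≥0) : ℂ) := by
        rw [continuous_iff_continuousAt]
        intro x
        by_cases hx : f₁ x + f₂ x = 0
        · have hgx : g x = 0 := by
            have := hg x
            simp only [Pi.add_apply, hx] at this
            simpa using this
          rw [ContinuousAt, hgx, zero_mul]
          have h2 : Tendsto (fun y => ‖g y‖) (𝓝 x) (𝓝 0) := by
            have := (g.continuous.norm).tendsto x
            simpa [hgx] using this
          refine squeeze_zero_norm (fun y => ?_) h2
          rw [norm_mul]
          refine mul_le_of_le_one_right (norm_nonneg _) ?_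
          have : f₁ y / (f₁ y + f₂ y) ≤ 1 := div_le_one_of_le₀ (by simp) (by simp)
          rw [← coe_nnnorm, hn]
          exact_mod_cast this
        · refine g.continuous.continuousAt.mul ?_
          refine ContinuousAt.comp (g := fun r : ℝ≥0 => (r : ℂ)) (by fun_prop) ?_
          exact h₁.continuousAt.div (h₁.add h₂).continuousAt hx
      let g₁ : C(K, ℂ) := ⟨_, hcont⟩
      have e : Ψ g = Ψ g₁ + Ψ (g - g₁) := by rw [← map_add]; congr 1; abel
      rw [e]
      refine (nnnorm_add_le _ _).trans (add_le_add (hle f₁ h₁ _ fun x => ?_)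
        (hle f₂ h₂ _ fun x => ?_))
      · have hx := hg x
        simp only [Pi.add_apply] at hx
        simp only [g₁, ContinuousMap.coe_mk, nnnorm_mul]
        by_cases hz : f₁ x + f₂ x = 0
        · simp [hz]
        rw [hn]
        calc _ ≤ (f₁ x + f₂ x) * (f₁ x / (f₁ x + f₂ x)) := by gcongr
          _ = f₁ x := by field_simp
      · have hx := hg x
        simp only [Pi.add_apply] at hx
        simp only [g₁, ContinuousMap.sub_apply, ContinuousMap.coe_mk]
        by_cases hz : f₁ x + f₂ x = 0
        · have : g x = 0 := by rw [hz] at hx; simpa using hx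
          simp [this]
        have hz' : ((f₁ x : ℂ) + f₂ x) ≠ 0 := by exact_mod_cast hz
        have h3 : g x - g x * ((f₁ x / (f₁ x + f₂ x) : ℝ≥0) : ℂ)
            = g x * ((f₂ x / (f₁ x + f₂ x) : ℝ≥0) : ℂ) := by
          push_cast
          field_simp
          ring
        rw [h3, nnnorm_mul, hn]
        calc _ ≤ (f₁ x + f₂ x) * (f₂ x / (f₁ x + f₂ x)) := by gcongr
          _ = f₂ x := by field_simp
    · have key : ∀ a ∈ A f₁, ∀ b ∈ A f₂, a + b ≤ P (f₁ + f₂) := by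
        rintro a ⟨g₁, hg₁, rfl⟩ b ⟨g₂, hg₂, rfl⟩
        obtain ⟨c₁, hc₁, e₁⟩ := hphase g₁
        obtain ⟨c₂, hc₂, e₂⟩ := hphase g₂
        have h := hle (f₁ + f₂) (h₁.add h₂) (c₁ • g₁ + c₂ • g₂) fun x => by
          refine (nnnorm_add_le _ _).trans (add_le_add ?_ ?_)
          · simpa [nnnorm_smul, hc₁] using hg₁ x
          · simpa [nnnorm_smul, hc₂] using hg₂ x
        rw [map_add, e₁, e₂] at h
        have e3 : ‖(‖Ψ g₁‖ : ℂ) + (‖Ψ g₂‖ : ℂ)‖₊ = ‖Ψ g₁‖₊ + ‖Ψ g₂‖₊ := by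
          apply NNReal.eq
          rw [← Complex.ofReal_add]
          simp only [coe_nnnorm, NNReal.coe_add, Complex.norm_real, Real.norm_eq_abs]
          exact abs_of_nonneg (by positivity)
        rwa [e3] at h
      have h4 : ∀ b ∈ A f₂, P f₁ ≤ P (f₁ + f₂) - b := fun b hb =>
        csSup_le (hne _) fun a ha => le_tsub_of_add_le_right (key a ha b hb)
      have h5 : ∀ b ∈ A f₂, b ≤ P (f₁ + f₂) - P f₁ := fun b hb => by
        refine le_tsub_of_add_le_left ?_
        obtain ⟨a, ha⟩ := hne f₁
        have hb' : b ≤ P (f₁ + f₂) := (le_add_of_nonneg_left (zero_le (a := a))).trans (key a ha b hb)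
        calc P f₁ + b ≤ (P (f₁ + f₂) - b) + b := by gcongr; exact h4 b hb
          _ = _ := tsub_add_cancel_of_le hb'
      have h6 : P f₂ ≤ P (f₁ + f₂) - P f₁ := csSup_le (hne _) h5
      have h7 : P f₁ ≤ P (f₁ + f₂) := by
        obtain ⟨b, hb⟩ := hne f₂
        exact (h4 b hb).trans tsub_le_self
      calc P f₁ + P f₂ ≤ P f₁ + (P (f₁ + f₂) - P f₁) := by gcongr
        _ = _ := add_tsub_cancel_of_le h7
  have hsmul_le : ∀ (c : ℝ≥0) (f : K → ℝ≥0), Continuous f → c * P f ≤ P (c • f) := by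
    intro c f hf
    by_cases hc : c = 0
    · simp [hc]
    suffices h : P f ≤ c⁻¹ * P (c • f) by
      calc c * P f ≤ c * (c⁻¹ * P (c • f)) := by gcongr
        _ = _ := by field_simp
    refine csSup_le (hne f) ?_
    rintro _ ⟨g, hg, rfl⟩
    have h := hle (c • f) (by fun_prop) ((c : ℂ) • g) fun x => by
      simp only [ContinuousMap.smul_apply, nnnorm_mul, hn, Pi.smul_apply, smul_eq_mul]
      gcongr
      exact hg x
    rw [map_smul, nnnorm_smul, hn] at h
    calc ‖Ψ g‖₊ = c⁻¹ * (c * ‖Ψ g‖₊) := by field_simp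
      _ ≤ _ := by gcongr
  have hsmul : ∀ (c : ℝ≥0) (f : K → ℝ≥0), Continuous f → P (c • f) = c * P f := by
    intro c f hf
    refine le_antisymm ?_ (hsmul_le c f hf)
    by_cases hc : c = 0
    · have h := hadd 0 0 continuous_const continuous_const
      simp only [add_zero] at h
      have h0 : P 0 = 0 := by simpa using h
      simp [hc, h0]
    · have h := hsmul_le c⁻¹ (c • f) (by fun_prop)
      rw [inv_smul_smul₀ hc] at h
      calc P (c • f) = c * (c⁻¹ * P (c • f)) := by field_simp
        _ ≤ _ := by gcongr
  let Λ : CompactlySupportedContinuousMap K ℝ≥0 →ₗ[ℝ≥0] ℝ≥0 :=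
    { toFun := fun f => P f
      map_add' := fun f g => by
        simpa using hadd f g f.continuous g.continuous
      map_smul' := fun c f => by
        simpa using hsmul c f f.continuous }
  refine ⟨NNRealRMK.rieszMeasure Λ, inferInstance, fun g => ?_⟩
  let f : CompactlySupportedContinuousMap K ℝ≥0 :=
    CompactlySupportedContinuousMap.continuousMapEquiv ⟨fun x => ‖g x‖₊, by fun_prop⟩
  have h := NNRealRMK.integral_rieszMeasure Λ f
  have h2 : ‖Ψ g‖₊ ≤ Λ f := hle _ f.continuous g fun x => le_rfl
  calc ‖Ψ g‖ ≤ (Λ f : ℝ) := by exact_mod_cast h2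
    _ = _ := h.symm

/-- A bounded family `F` of continuous functions on a compact space, indexed by a compact space so
that `s ↦ F s t` is continuous for every `t`, is weakly continuous in `s`. -/
theorem continuous_apply_of_separately {S T : Type*} [TopologicalSpace S] [CompactSpace S]
    [TopologicalSpace T] [CompactSpace T] [T2Space T] (F : S → C(T, ℂ))
    (hF : ∀ t, Continuous fun s => F s t) (C : ℝ) (hC : ∀ s, ‖F s‖ ≤ C)
    (Ψ : StrongDual ℂ C(T, ℂ)) : Continuous fun s => Ψ (F s) := by
  classical
  rw [continuous_iff_continuousAt]
  intro s₀
  by_contra hcon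
  obtain ⟨ε, hε, hfreq⟩ : ∃ ε > 0, ∃ᶠ s in 𝓝 s₀, ε ≤ ‖Ψ (F s) - Ψ (F s₀)‖ := by
    rw [ContinuousAt, Metric.tendsto_nhds] at hcon
    push Not at hcon
    obtain ⟨ε, hε, h⟩ := hcon
    exact ⟨ε, hε, h.mono fun s hs => by simpa [dist_eq_norm] using hs⟩
  -- every finite family of continuous functions has finite nets
  have hnet : ∀ (B : Finset S) (δ : ℝ), 0 < δ → ∃ D : Finset T, ∀ t, ∃ t' ∈ D, ∀ a ∈ B,
      ‖F a t - F a t'‖ < δ := by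
    intro B δ hδ
    have hU : ∀ t' : T, {t | ∀ a ∈ B, ‖F a t - F a t'‖ < δ} ∈ 𝓝 t' := by
      intro t'
      have : ∀ a ∈ B, ∀ᶠ t in 𝓝 t', ‖F a t - F a t'‖ < δ := fun a _ => by
        have h : Continuous fun t => ‖F a t - F a t'‖ := by fun_prop
        exact h.continuousAt.eventually_lt continuousAt_const (by simpa using hδ)
      exact (eventually_all_finset B).2 this
    obtain ⟨D, -, hD⟩ := isCompact_univ.elim_nhds_subcover
      (fun t' : T => {t | ∀ a ∈ B, ‖F a t - F a t'‖ < δ}) fun t' _ => hU t'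
    refine ⟨D, fun t => ?_⟩
    obtain ⟨t', ht', h⟩ := Set.mem_iUnion₂.1 (hD (Set.mem_univ t))
    exact ⟨t', ht', h⟩
  obtain ⟨q, hq1, hq2⟩ := exists_seq_of_forall_finset_exists
    (α := S × Finset S × Finset T × ℕ)
    (fun y => ε ≤ ‖Ψ (F y.1) - Ψ (F s₀)‖ ∧ ∀ t, ∃ t' ∈ y.2.2.1, ∀ a ∈ insert s₀ y.2.1,
      ‖F a t - F a t'‖ < 1 / ((y.2.2.2 : ℝ) + 1))
    (fun x y => x.2.2.2 < y.2.2.2 ∧ x.1 ∈ y.2.1 ∧ ∀ t ∈ x.2.2.1,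
      ‖F y.1 t - F s₀ t‖ < 1 / ((y.2.2.2 : ℝ) + 1)) (by
    intro X _
    let k : ℕ := X.sup (fun x => x.2.2.2) + 1
    have hk : (0 : ℝ) < 1 / ((k : ℝ) + 1) := by positivity
    have hev : ∀ᶠ s in 𝓝 s₀, ∀ t ∈ X.biUnion (fun x => x.2.2.1),
        ‖F s t - F s₀ t‖ < 1 / ((k : ℝ) + 1) := by
      rw [eventually_all_finset]
      intro t _
      have h : Continuous fun s => ‖F s t - F s₀ t‖ := ((hF t).sub continuous_const).norm
      exact h.continuousAt.eventually_lt continuousAt_const (by simpa using hk)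
    obtain ⟨s, hs1, hs2⟩ := (hfreq.and_eventually hev).exists
    obtain ⟨D, hD⟩ := hnet (insert s₀ (X.image fun x => x.1)) _ hk
    refine ⟨(s, X.image fun x => x.1, D, k), ⟨hs1, hD⟩, fun x hx => ⟨?_, ?_, ?_⟩⟩
    · exact Nat.lt_succ_of_le (Finset.le_sup (f := fun x => x.2.2.2) hx)
    · exact Finset.mem_image_of_mem _ hx
    · intro t ht
      exact hs2 t (Finset.mem_biUnion.2 ⟨x, hx, ht⟩))
  set s : ℕ → S := fun n => (q n).1 with hs
  have hk : ∀ n, n ≤ (q n).2.2.2 := by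
    have : StrictMono fun n => (q n).2.2.2 := fun m n h => (hq2 m n h).1
    exact this.id_le
  have hsmall : ∀ n, 1 / (((q n).2.2.2 : ℝ) + 1) ≤ 1 / ((n : ℝ) + 1) := fun n => by
    have := hk n
    gcongr
  have hzero : Tendsto (fun n : ℕ => 1 / ((n : ℝ) + 1)) atTop (𝓝 0) :=
    tendsto_one_div_add_atTop_nhds_zero_nat
  have hpt : ∀ t, Tendsto (fun n => F (s n) t) atTop (𝓝 (F s₀ t)) := by
    intro t
    rw [tendsto_iff_ultrafilter]
    intro U hU
    obtain ⟨s', -, hs'⟩ := isCompact_univ.ultrafilter_le_nhds (U.map s) (by simp)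
    have hs'U : Tendsto s U (𝓝 s') := hs'
    choose p hpD hp using fun n => (hq1 n).2 t
    obtain ⟨t', -, ht'⟩ := isCompact_univ.ultrafilter_le_nhds (U.map p) (by simp)
    have ht'U : Tendsto p U (𝓝 t') := ht'
    have hlim : ∀ u, Tendsto (fun n => F (s n) u) U (𝓝 (F s' u)) := fun u =>
      ((hF u).tendsto s').comp hs'U
    -- a function controlled by the nets does not distinguish `t` and `t'`
    have hsame : ∀ a : S, (∃ m, ∀ n, m < n → a ∈ insert s₀ (q n).2.1) → F a t = F a t' := by
      rintro a ⟨m, hm⟩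
      have h1 : Tendsto (fun n => F a t - F a (p n)) U (𝓝 (F a t - F a t')) :=
        tendsto_const_nhds.sub (((F a).continuous.tendsto t').comp ht'U)
      have h2 : Tendsto (fun n => F a t - F a (p n)) U (𝓝 0) := by
        refine squeeze_zero_norm' ?_ (hzero.mono_left hU)
        filter_upwards [hU (eventually_gt_atTop m)] with n hn
        exact ((hp n a (hm n hn)).trans_le (hsmall n)).le
      exact sub_eq_zero.1 (tendsto_nhds_unique h1 h2)
    have e0 : F s₀ t = F s₀ t' := hsame s₀ ⟨0, fun n _ => Finset.mem_insert_self _ _⟩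
    have em : ∀ m, F (s m) t = F (s m) t' := fun m =>
      hsame _ ⟨m, fun n hn => Finset.mem_insert_of_mem (hq2 m n hn).2.1⟩
    have e1 : F s' t = F s' t' :=
      tendsto_nhds_unique (hlim t) (by simpa only [em] using hlim t')
    have eD : ∀ m, F s' (p m) = F s₀ (p m) := by
      intro m
      have h2 : Tendsto (fun n => F (s n) (p m) - F s₀ (p m)) U (𝓝 0) := by
        refine squeeze_zero_norm' ?_ (hzero.mono_left hU)
        filter_upwards [hU (eventually_gt_atTop m)] with n hn
        exact (((hq2 m n hn).2.2 _ (hpD m)).trans_le (hsmall n)).le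
      exact sub_eq_zero.1 (tendsto_nhds_unique ((hlim (p m)).sub tendsto_const_nhds) h2)
    have e2 : F s' t' = F s₀ t' := by
      have h1 : Tendsto (fun n => F s' (p n)) U (𝓝 (F s' t')) :=
        ((F s').continuous.tendsto t').comp ht'U
      have h2 : Tendsto (fun n => F s₀ (p n)) U (𝓝 (F s₀ t')) :=
        ((F s₀).continuous.tendsto t').comp ht'U
      simp only [eD] at h1
      exact tendsto_nhds_unique h1 h2
    have : F s' t = F s₀ t := by rw [e1, e2, e0]
    rw [← this]
    exact hlim t
  borelize T
  obtain ⟨μ, hμ, hΨ⟩ := exists_dominating_measure Ψ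
  have hint : Tendsto (fun n => ∫ t, ‖(F (s n) - F s₀) t‖ ∂μ) atTop (𝓝 (∫ _, (0 : ℝ) ∂μ)) := by
    refine tendsto_integral_of_dominated_convergence (fun _ => C + C) (fun n => ?_)
      (integrable_const _) (fun n => ?_) ?_
    · exact (map_continuous (F (s n) - F s₀)).norm.measurable.aestronglyMeasurable
    · refine Eventually.of_forall fun t => ?_
      rw [norm_norm]
      exact ((F (s n) - F s₀).norm_coe_le_norm t).trans
        ((norm_sub_le _ _).trans (add_le_add (hC _) (hC _)))
    · refine Eventually.of_forall fun t => ?_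
      have := ((hpt t).sub_const (F s₀ t)).norm
      simpa using this
  rw [integral_zero] at hint
  obtain ⟨n, hn⟩ := (hint.eventually (gt_mem_nhds hε)).exists
  have h1 := (hq1 n).1
  rw [← map_sub] at h1
  exact absurd ((h1.trans (hΨ _)).trans_lt hn) (lt_irrefl _)

section Convolution

variable {S : Type*} [TopologicalSpace S] [CompactSpace S] [AddSemigroup S]
  [SeparatelyContinuousAdd S]

/-- The translate `s ↦ f(s + t)` of a continuous function `f`. -/
def translate (t : S) (f : C(S, ℂ)) : C(S, ℂ) :=
  ⟨fun s => f (s + t), f.continuous.comp SeparatelyContinuousAdd.continuous_add_const⟩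

theorem norm_translate_le (t : S) (f : C(S, ℂ)) : ‖translate t f‖ ≤ ‖f‖ :=
  (ContinuousMap.norm_le _ (norm_nonneg f)).2 fun s => f.norm_coe_le_norm (s + t)

variable [T2Space S]

/-- The inner integral `t ↦ ∫ f(s + t) dΦ(s)`, a continuous function on `S`. -/
def innerIntegral (Φ : M S) (f : C(S, ℂ)) : C(S, ℂ) :=
  ⟨fun t => Φ (translate t f), continuous_apply_of_separately (fun t => translate t f)
    (fun _ => f.continuous.comp SeparatelyContinuousAdd.continuous_const_add) ‖f‖
    (fun t => norm_translate_le t f) Φ⟩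

/-- The convolution product on `M(S)`: `⟨Φ * Ψ, f⟩ = ∫ (∫ f(s + t) dΦ(s)) dΨ(t)`. -/
def conv (Φ Ψ : M S) : M S :=
  LinearMap.mkContinuous
    { toFun := fun f => Ψ (innerIntegral Φ f)
      map_add' := fun f g => by
        rw [← map_add]
        congr 1
        ext t
        exact map_add Φ (translate t f) (translate t g)
      map_smul' := fun c f => by
        rw [RingHom.id_apply, ← map_smul]
        congr 1
        ext t
        exact map_smul Φ c (translate t f) }
    (‖Ψ‖ * ‖Φ‖) (fun f => by
      rw [mul_assoc]
      refine Ψ.le_opNorm_of_le ((ContinuousMap.norm_le _ (by positivity)).2 fun t => ?_)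
      exact Φ.le_opNorm_of_le (norm_translate_le t f))

theorem conv_apply (Φ Ψ : M S) (f : C(S, ℂ)) : conv Φ Ψ f = Ψ (innerIntegral Φ f) := rfl

end Convolution

/-! ### Projections of `M(S)` onto `ℓ₁(ℤ)` and their preannihilators -/

namespace SemigroupCompactification

variable (S : SemigroupCompactification.{u})

/-- Restriction of continuous functions on `S` to `ℤ`, which identifies `C(S)` with a subspace of
`ℓ_∞(ℤ)`. -/
def restrict : C(S.carrier, ℂ) →L[ℂ] Linf :=
  LinearMap.mkContinuous
    { toFun := fun f => ⟨fun n => f (S.emb n), by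
        refine memℓp_infty ⟨‖f‖, ?_⟩
        rintro _ ⟨n, rfl⟩
        exact f.norm_coe_le_norm _⟩
      map_add' := fun _ _ => rfl
      map_smul' := fun _ _ => rfl }
    1 (fun f => by
      rw [one_mul]
      exact lp.norm_le_of_forall_le (norm_nonneg f) fun n => f.norm_coe_le_norm _)

/-- The canonical inclusion `ℓ₁(ℤ) → M(S)`, `a ↦ ∑ₙ a(n) δₙ`. -/
def incl : L1 →L[ℂ] M S.carrier := (pairing.comp S.restrict).flip

theorem incl_apply (a : L1) (f : C(S.carrier, ℂ)) :
    S.incl a f = ∑' n : ℤ, f (S.emb n) * a n := rfl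

/-- `Θ : M(S) → ℓ₁(ℤ)` is a bounded projection (it fixes `ℓ₁(ℤ) ⊆ M(S)` pointwise) that is a
homomorphism for the convolution products and has weak*-closed kernel. -/
structure IsAdmissible (Θ : M S.carrier →L[ℂ] L1) : Prop where
  projection : ∀ a : L1, Θ (S.incl a) = a
  map_conv : ∀ Φ Ψ : M S.carrier, Θ (conv Φ Ψ) = l1Conv (Θ Φ) (Θ Ψ)
  ker_weakStar_closed :
    IsClosed {Φ : WeakDual ℂ C(S.carrier, ℂ) | Θ (WeakDual.toStrongDual Φ) = 0}

/-- The preannihilator `{f ∈ C(S) : ⟨Ψ, f⟩ = 0 for all Ψ ∈ ker Θ}`. -/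
def preannihilator (Θ : M S.carrier →L[ℂ] L1) : Submodule ℂ C(S.carrier, ℂ) where
  carrier := {f | ∀ Ψ : M S.carrier, Θ Ψ = 0 → Ψ f = 0}
  add_mem' := fun hf hg Ψ hΨ => by rw [map_add, hf Ψ hΨ, hg Ψ hΨ, add_zero]
  zero_mem' := fun Ψ _ => map_zero Ψ
  smul_mem' := fun c f hf Ψ hΨ => by rw [map_smul, hf Ψ hΨ, smul_zero]

/-- The preannihilator of `ker Θ`, identified by restriction to `ℤ` with a subspace of
`ℓ_∞(ℤ)`. -/
def inducedSubspace (Θ : M S.carrier →L[ℂ] L1) : Submodule ℂ Linf :=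
  (S.preannihilator Θ).map (S.restrict : C(S.carrier, ℂ) →ₗ[ℂ] Linf)

end SemigroupCompactification

end ShiftPredual

end

noncomputable section

open scoped ENNReal

namespace ShiftPredual

/-! Both directions rest on the duality between C(S) and M(S).

Given Θ, a weak*-closed kernel is the annihilator of its preannihilator F
(`mem_ker_of_annihilates`). The projection splits M(S) into ℓ₁(ℤ) and ker Θ, so F* is M(S)/ker Θ,
that is ℓ₁(ℤ) (`iota_injective`, `iota_surjective`). Multiplicativity makes ker Θ an ideal, and
therefore F is stable under translation by integers.

Given E, convolution is transported to E* ≅ ℓ₁(ℤ). Being closed and shift-invariant, E is an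
ℓ₁(ℤ)-module, and convolution by a on E* is the transpose of the action of a on E
(`dualConv_apply`). Hence the product on E* is separately weak*-continuous. Take S to be the
weak*-closure of the point masses in E*: it is compact by Banach–Alaoglu and closed under the
product. Evaluation embeds E in C(S), and Θ is the transpose M(S) → E* ≅ ℓ₁(ℤ). Its kernel is the
annihilator of E, and Θ(δ_s) is s itself read in ℓ₁(ℤ), whence injectivity. Multiplicativity comes
from `innerIntegral_evaluation`. -/

/-- The open mapping theorem, for continuous linear maps between Banach spaces. -/
theorem isInvertible_of_bijective {X Y : Type*} [NormedAddCommGroup X] [NormedSpace ℂ X]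
    [CompleteSpace X] [NormedAddCommGroup Y] [NormedSpace ℂ Y] [CompleteSpace Y] (f : X →L[ℂ] Y)
    (hinj : Function.Injective f) (hsurj : Function.Surjective f) : f.IsInvertible :=
  ⟨ContinuousLinearEquiv.ofBijective f (LinearMap.ker_eq_bot.2 hinj)
    (LinearMap.range_eq_top.2 hsurj), ContinuousLinearEquiv.coe_ofBijective f _ _⟩

/-! ### Weak*-closed subspaces -/

/-- A point outside a closed subspace of a locally convex space is separated from it by a
continuous functional. -/
theorem exists_dual_separating {X : Type*} [AddCommGroup X] [Module ℂ X] [Module ℝ X]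
    [IsScalarTower ℝ ℂ X] [TopologicalSpace X] [IsTopologicalAddGroup X] [ContinuousSMul ℂ X]
    [LocallyConvexSpace ℝ X] (N : Submodule ℂ X) (hN : IsClosed (N : Set X)) {x : X} (hx : x ∉ N) :
    ∃ f : StrongDual ℂ X, (∀ y ∈ N, f y = 0) ∧ f x ≠ 0 := by
  obtain ⟨f, r, hf, hr⟩ := RCLike.geometric_hahn_banach_closed_point (𝕜 := ℂ)
    (N.restrictScalars ℝ).convex hN hx
  refine ⟨f, fun y hy => ?_, fun h => ?_⟩
  · by_contra h
    -- If f did not vanish at y, this multiple of y would lie in N and have f-value exactly r,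
    -- against the strict bound.
    have h1 := hf (((r : ℂ) / f y) • y) (N.smul_mem _ hy)
    rw [map_smul, smul_eq_mul, div_mul_cancel₀ _ h] at h1
    simp at h1
  · have h0 := hf 0 N.zero_mem
    rw [h] at hr
    rw [map_zero] at h0
    exact lt_asymm h0 hr

/-- A point outside a weakly closed subspace is separated from it by a weakly continuous
functional. -/
theorem exists_separating_weakBilin {F X : Type*} [AddCommGroup F] [Module ℂ F] [AddCommGroup X]
    [Module ℂ X] (B : F →ₗ[ℂ] X →ₗ[ℂ] ℂ) (N : Submodule ℂ (WeakBilin B))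
    (hN : IsClosed (N : Set (WeakBilin B))) {φ : WeakBilin B} (hφ : φ ∉ N) :
    ∃ x : X, (∀ ψ ∈ N, B ψ x = 0) ∧ B φ x ≠ 0 := by
  obtain ⟨f, hf, hfφ⟩ := exists_dual_separating N hN hφ
  -- Every functional continuous for the weak topology of a pairing is evaluation at some x.
  obtain ⟨x, rfl⟩ := LinearMap.dualEmbedding_surjective B f
  exact ⟨x, hf, hfφ⟩

/-- A weak*-closed subspace of a dual Banach space is the annihilator of its preannihilator. -/
theorem exists_separating_of_notMem {X : Type*} [NormedAddCommGroup X] [NormedSpace ℂ X]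
    (N : Submodule ℂ (WeakDual ℂ X)) (hN : IsClosed (N : Set (WeakDual ℂ X)))
    {φ : WeakDual ℂ X} (hφ : φ ∉ N) : ∃ x : X, (∀ ψ ∈ N, ψ x = 0) ∧ φ x ≠ 0 :=
  exists_separating_weakBilin (topDualPairing ℂ X) N hN hφ

/-! ### Point masses in `ℓ₁(ℤ)` -/

/-- The point mass at `n`, as an element of `ℓ₁(ℤ)`. -/
def unit (n : ℤ) : L1 := lp.single 1 n 1

theorem unit_apply (n k : ℤ) : unit n k = if k = n then 1 else 0 := by
  rw [unit, lp.single_apply, Pi.single_apply]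

theorem pairing_unit (x : Linf) (n : ℤ) : pairing x (unit n) = x n := by
  rw [pairing_apply, tsum_eq_single n]
  · simp [unit_apply]
  · intro k hk
    simp [unit_apply, hk]

theorem norm_le_of_forall_apply {x : Linf} {C : ℝ} (hC : 0 ≤ C) (h : ∀ n, ‖x n‖ ≤ C) : ‖x‖ ≤ C :=
  lp.norm_le_of_forall_le hC h

theorem l1Conv_apply (a b : L1) (n : ℤ) : l1Conv a b n = ∑' m : ℤ, a m * b (n - m) := rfl

theorem l1Conv_zero (a : L1) : l1Conv a 0 = 0 := by
  ext n
  simp [l1Conv_apply]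

theorem shift_apply (x : Linf) (n : ℤ) : shift x n = x (n - 1) := rfl

set_option maxHeartbeats 1000000 in
theorem isInvertible_iota_of_bijective {F : Submodule ℂ Linf}
    (hinj : Function.Injective (iota F)) (hsurj : Function.Surjective (iota F)) :
    (iota F).IsInvertible :=
  isInvertible_of_bijective (X := L1) (Y := StrongDual ℂ F) (iota F) hinj hsurj

/-! ### The predual induced by a projection -/

namespace SemigroupCompactification

variable (S : SemigroupCompactification.{u})

theorem restrict_apply (f : C(S.carrier, ℂ)) (n : ℤ) : S.restrict f n = f (S.emb n) := rfl

/-- Since ℤ is dense in S, the supremum of |f| over ℤ is already the supremum over S. -/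
theorem norm_restrict (f : C(S.carrier, ℂ)) : ‖S.restrict f‖ = ‖f‖ := by
  apply le_antisymm
  · exact norm_le_of_forall_apply (norm_nonneg f) fun n => f.norm_coe_le_norm _
  · refine (ContinuousMap.norm_le _ (norm_nonneg _)).2 fun s => ?_
    refine S.emb_denseRange.induction_on (p := fun s => ‖f s‖ ≤ ‖S.restrict f‖) s
      (isClosed_le (by fun_prop) continuous_const) fun n => ?_
    exact lp.norm_apply_le_norm (by simp) (S.restrict f) n

theorem isometry_restrict : Isometry S.restrict :=
  AddMonoidHomClass.isometry_of_norm _ S.norm_restrict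

theorem isClosed_preannihilator (Θ : M S.carrier →L[ℂ] L1) :
    IsClosed (S.preannihilator Θ : Set C(S.carrier, ℂ)) := by
  have : (S.preannihilator Θ : Set C(S.carrier, ℂ)) =
      ⋂ Ψ : M S.carrier, ⋂ _ : Θ Ψ = 0, {f | Ψ f = 0} := by
    ext f
    simp only [Set.mem_iInter]
    rfl
  rw [this]
  exact isClosed_iInter fun Ψ => isClosed_iInter fun _ =>
    isClosed_eq Ψ.continuous continuous_const

variable {S} {Θ : M S.carrier →L[ℂ] L1}

theorem mem_inducedSubspace {x : Linf} :
    x ∈ S.inducedSubspace Θ ↔ ∃ f ∈ S.preannihilator Θ, S.restrict f = x := Iff.rfl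

theorem isClosed_inducedSubspace : IsClosed (S.inducedSubspace Θ : Set Linf) := by
  have h := S.isometry_restrict.isClosedEmbedding.isClosedMap _ (S.isClosed_preannihilator Θ)
  exact h

namespace IsAdmissible

/-- The bipolar argument; this is where weak*-closedness of the kernel enters. -/
theorem mem_ker_of_annihilates (hΘ : S.IsAdmissible Θ) {Φ : M S.carrier}
    (h : ∀ f ∈ S.preannihilator Θ, Φ f = 0) : Θ Φ = 0 := by
  by_contra hne
  let N : Submodule ℂ (WeakDual ℂ C(S.carrier, ℂ)) :=
    LinearMap.ker (Θ.toLinearMap ∘ₗ WeakDual.toStrongDual.toLinearMap)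
  obtain ⟨f, hf, hf'⟩ := exists_separating_of_notMem N hΘ.ker_weakStar_closed
    (φ := StrongDual.toWeakDual Φ) hne
  exact hf' (h f fun Ψ hΨ => hf (StrongDual.toWeakDual Ψ) hΨ)

/-- An element of ℓ₁(ℤ) that annihilates the preannihilator lies in ker Θ, yet Θ fixes it. -/
theorem iota_injective (hΘ : S.IsAdmissible Θ) :
    Function.Injective (iota (S.inducedSubspace Θ)) := by
  refine (injective_iff_map_eq_zero _).2 fun a ha => ?_
  rw [← hΘ.projection a]
  refine hΘ.mem_ker_of_annihilates fun f hf => ?_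
  exact DFunLike.congr_fun ha (⟨S.restrict f, f, hf, rfl⟩ : S.inducedSubspace Θ)

/-- Extend the functional to ℓ_∞(ℤ) by Hahn–Banach and pull it back to a measure Φ. Its image ΘΦ
represents the functional, because Φ and ΘΦ differ by an element of ker Θ, which the preannihilator
does not see. -/
theorem iota_surjective (hΘ : S.IsAdmissible Θ) :
    Function.Surjective (iota (S.inducedSubspace Θ)) := by
  intro φ
  obtain ⟨g, hg, -⟩ := exists_extension_norm_eq (S.inducedSubspace Θ) φ
  refine ⟨Θ (g.comp S.restrict), ContinuousLinearMap.ext fun x => ?_⟩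
  obtain ⟨f, hf, hfx⟩ := x.2
  have h : (S.incl (Θ (g.comp S.restrict)) - g.comp S.restrict) f = 0 :=
    hf _ (by rw [map_sub, hΘ.projection, sub_self])
  have h1 : pairing (S.restrict f) (Θ (g.comp S.restrict)) = g (S.restrict f) := sub_eq_zero.1 h
  rw [← hg, ← hfx]
  exact (congrArg (fun y => pairing y (Θ (g.comp S.restrict))) hfx.symm).trans h1

theorem isInvertible_iota (hΘ : S.IsAdmissible Θ) :
    (iota (S.inducedSubspace Θ)).IsInvertible :=
  isInvertible_iota_of_bijective hΘ.iota_injective hΘ.iota_surjective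

/-- The preannihilator is invariant under translation by integers. -/
theorem innerIntegral_dirac_mem (hΘ : S.IsAdmissible Θ) (s : S.carrier) {f : C(S.carrier, ℂ)}
    (hf : f ∈ S.preannihilator Θ) : innerIntegral (dirac s) f ∈ S.preannihilator Θ := by
  intro Ψ hΨ
  -- The value of Ψ here is that of δ_s * Ψ at f, and δ_s * Ψ stays in ker Θ.
  rw [← conv_apply]
  exact hf _ (by rw [hΘ.map_conv, hΨ, l1Conv_zero])

theorem isShiftInvariantPredual (hΘ : S.IsAdmissible Θ) :
    IsShiftInvariantPredual (S.inducedSubspace Θ) where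
  isClosed := isClosed_inducedSubspace
  isInvertible := hΘ.isInvertible_iota
  shift_mem_iff x := by
    constructor
    · rintro ⟨f, hf, hfx⟩
      -- Translating by 1 undoes the shift; translating by -1, in the other direction, performs it.
      refine ⟨_, hΘ.innerIntegral_dirac_mem (S.emb 1) hf, ?_⟩
      ext n
      have h := congrArg (fun y : Linf => y (1 + n)) hfx
      change f (S.emb 1 + S.emb n) = x n
      rw [← map_add]
      simpa [shift_apply, restrict_apply] using! h
    · rintro ⟨f, hf, rfl⟩
      refine ⟨_, hΘ.innerIntegral_dirac_mem (S.emb (-1)) hf, ?_⟩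
      ext n
      change f (S.emb (-1) + S.emb n) = f (S.emb (n - 1))
      rw [← map_add, neg_add_eq_sub]

end IsAdmissible

end SemigroupCompactification


/-! ### The module action of `ℓ₁(ℤ)` on `ℓ_∞(ℤ)` -/

/-- Translation by `k` on `ℓ_∞(ℤ)`: `x ↦ (n ↦ x (n + k))`. -/
def shiftBy (k : ℤ) : Linf →L[ℂ] Linf :=
  LinearMap.mkContinuous
    { toFun := fun x => ⟨fun n => x (n + k), by
        refine memℓp_infty ⟨‖x‖, ?_⟩
        rintro _ ⟨n, rfl⟩
        exact lp.norm_apply_le_norm (by simp) x (n + k)⟩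
      map_add' := fun _ _ => rfl
      map_smul' := fun _ _ => rfl }
    1 (fun x => by
      rw [one_mul]
      exact norm_le_of_forall_apply (norm_nonneg x)
        fun n => lp.norm_apply_le_norm (by simp) x (n + k))

theorem shiftBy_apply (k : ℤ) (x : Linf) (n : ℤ) : shiftBy k x n = x (n + k) := rfl

theorem norm_shiftBy_le (k : ℤ) : ‖shiftBy k‖ ≤ 1 :=
  LinearMap.mkContinuous_norm_le _ zero_le_one _

theorem shiftBy_shiftBy (j k : ℤ) (x : Linf) : shiftBy j (shiftBy k x) = shiftBy (j + k) x := by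
  ext n
  simp only [shiftBy_apply, add_assoc]

theorem shiftBy_comm (j k : ℤ) (x : Linf) :
    shiftBy j (shiftBy k x) = shiftBy k (shiftBy j x) := by
  rw [shiftBy_shiftBy, shiftBy_shiftBy, add_comm]

theorem summable_norm (a : L1) : Summable fun n : ℤ => ‖a n‖ := by
  simpa using (lp.memℓp a).summable (by simp)

theorem summable_smul_shiftBy (a : L1) (x : Linf) : Summable fun k : ℤ => a k • shiftBy k x := by
  refine Summable.of_norm_bounded ((summable_norm a).mul_right ‖x‖) fun k => ?_
  rw [norm_smul]
  gcongr
  simpa using (shiftBy k).le_of_opNorm_le (norm_shiftBy_le k) x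

/-- The action of `a ∈ ℓ₁(ℤ)` on `ℓ_∞(ℤ)`, dual to convolution by `a`. -/
def act (a : L1) (x : Linf) : Linf := ∑' k : ℤ, a k • shiftBy k x

theorem map_act {Y : Type*} [NormedAddCommGroup Y] [NormedSpace ℂ Y] (T : Linf →L[ℂ] Y) (a : L1)
    (x : Linf) : T (act a x) = ∑' k : ℤ, a k • T (shiftBy k x) := by
  rw [act, T.map_tsum (summable_smul_shiftBy a x)]
  simp only [map_smul]

theorem shiftBy_act (k : ℤ) (a : L1) (x : Linf) :
    shiftBy k (act a x) = act a (shiftBy k x) := by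
  rw [map_act, act]
  simp only [shiftBy_comm k]

theorem norm_act_le (a : L1) (x : Linf) : ‖act a x‖ ≤ (∑' k, ‖a k‖) * ‖x‖ := by
  rw [← tsum_mul_right]
  refine tsum_of_norm_bounded ((summable_norm a).mul_right ‖x‖).hasSum fun k => ?_
  rw [norm_smul]
  gcongr
  simpa using (shiftBy k).le_of_opNorm_le (norm_shiftBy_le k) x

/-- `act a` as a continuous linear map. -/
def actCLM (a : L1) : Linf →L[ℂ] Linf :=
  LinearMap.mkContinuous
    { toFun := act a
      map_add' := fun x y => by
        simp only [act, map_add, smul_add]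
        exact (summable_smul_shiftBy a x).tsum_add (summable_smul_shiftBy a y)
      map_smul' := fun c x => by
        simp only [act, map_smul, RingHom.id_apply, smul_comm _ c]
        exact (summable_smul_shiftBy a x).tsum_const_smul c }
    (∑' k, ‖a k‖) (norm_act_le a)

theorem act_comm (a b : L1) (x : Linf) : act a (act b x) = act b (act a x) := by
  -- The bounded operator `actCLM a` is applied termwise to the series for `act b x`; it commutes
  -- with each translation.
  have h := map_act (actCLM a) b x
  change act a (act b x) = ∑' k : ℤ, b k • act a (shiftBy k x) at h
  exact h.trans (tsum_congr fun k => by rw [shiftBy_act])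

theorem pairing_act (a b : L1) (x : Linf) :
    pairing (act a x) b = ∑' k : ℤ, a k * pairing (shiftBy k x) b :=
  map_act (pairing.flip b) a x

/-! ### Convolution as the transpose of the action -/

theorem summable_mul_conv (x : Linf) (a b : L1) :
    Summable fun p : ℤ × ℤ => x p.1 * (a p.2 * b (p.1 - p.2)) := by
  refine Summable.of_norm_bounded ((summable_conv_prod a b).mul_left ‖x‖) fun p => ?_
  rw [norm_mul]
  gcongr
  exact lp.norm_apply_le_norm (by simp) x p.1

theorem tsum_mul_translate (x : ℤ → ℂ) (b : ℤ → ℂ) (c : ℂ) (k : ℤ) :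
    ∑' n : ℤ, x n * (c * b (n - k)) = c * ∑' n : ℤ, x (n + k) * b n := by
  rw [← tsum_mul_left, ← (Equiv.addRight k).tsum_eq]
  refine tsum_congr fun n => ?_
  simp only [Equiv.coe_addRight, add_sub_cancel_right]
  ring

theorem pairing_l1Conv_eq_tsum (x : Linf) (a b : L1) :
    pairing x (l1Conv a b) = ∑' n : ℤ, ∑' k : ℤ, x n * (a k * b (n - k)) := by
  rw [pairing_apply]
  exact tsum_congr fun n => tsum_mul_left.symm

theorem tsum_comm_mul_conv (x : Linf) (a b : L1) :
    ∑' n : ℤ, ∑' k : ℤ, x n * (a k * b (n - k)) = ∑' k : ℤ, ∑' n : ℤ, x n * (a k * b (n - k)) :=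
  (Summable.tsum_comm (f := fun n k => x n * (a k * b (n - k))) (summable_mul_conv x a b)).symm

/-- Fubini for an absolutely convergent double series, followed by the change of variable n ↦ n + k.
Identities between convolutions thereby reduce to identities between operators on ℓ_∞(ℤ). -/
theorem pairing_l1Conv (x : Linf) (a b : L1) :
    pairing x (l1Conv a b) = pairing (act a x) b :=
  (pairing_l1Conv_eq_tsum x a b).trans <| (tsum_comm_mul_conv x a b).trans <|
    (tsum_congr fun k => tsum_mul_translate x b (a k) k).trans (pairing_act a b x).symm

theorem eq_of_pairing_eq {a b : L1} (h : ∀ x, pairing x a = pairing x b) : a = b := by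
  have key : ∀ (c : L1) (n : ℤ), pairing (lp.single ∞ n 1) c = c n := by
    intro c n
    rw [pairing_apply, tsum_eq_single n]
    · simp [lp.single_apply]
    · intro k hk
      simp [lp.single_apply, hk]
  ext n
  rw [← key, h, key]

theorem l1Conv_comm (a b : L1) : l1Conv a b = l1Conv b a := by
  ext n
  rw [l1Conv_apply, l1Conv_apply, ← (Equiv.subLeft n).tsum_eq]
  refine tsum_congr fun k => ?_
  simp only [Equiv.subLeft_apply, sub_sub_cancel]
  ring

theorem l1Conv_assoc (a b c : L1) : l1Conv (l1Conv a b) c = l1Conv a (l1Conv b c) := by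
  refine eq_of_pairing_eq fun x => ?_
  -- With b moved to the innermost right place on both sides, associativity becomes commutation of
  -- the actions of a and c.
  rw [l1Conv_comm _ c, l1Conv_comm b c]
  simp only [pairing_l1Conv, act_comm]

theorem l1Conv_unit_unit (m n : ℤ) : l1Conv (unit m) (unit n) = unit (m + n) := by
  refine eq_of_pairing_eq fun x => ?_
  rw [pairing_l1Conv, pairing_act, tsum_eq_single m]
  · rw [pairing_unit, pairing_unit, shiftBy_apply, add_comm n m]
    simp [unit_apply]
  · intro k hk
    simp [unit_apply, hk]

theorem unit_injective : Function.Injective unit := by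
  intro m n h
  have h1 := congrArg (fun a : L1 => a m) h
  by_contra hne
  simp [unit_apply, hne] at h1

namespace IsShiftInvariantPredual

variable {E : Submodule ℂ Linf}

/-- The induction runs through positive and negative k because σ(E) = E, not merely σ(E) ⊆ E. -/
theorem shiftBy_mem (hE : IsShiftInvariantPredual E) (k : ℤ) {x : Linf} (hx : x ∈ E) :
    shiftBy k x ∈ E := by
  have hstep : ∀ k : ℤ, shiftBy (k + 1) x ∈ E ↔ shiftBy k x ∈ E := by
    intro k
    have : shift (shiftBy (k + 1) x) = shiftBy k x := by
      ext n
      simp only [shift_apply, shiftBy_apply]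
      rw [show n - 1 + (k + 1) = n + k by ring]
    rw [← hE.shift_mem_iff, this]
  induction k using Int.induction_on with
  | zero =>
    have : shiftBy 0 x = x := by
      ext n
      simp only [shiftBy_apply, add_zero]
    rwa [this]
  | succ k ih => exact (hstep k).2 ih
  | pred k ih => exact (hstep _).1 (by simpa using ih)

/-- The series of translates converges in norm and E is norm closed. -/
theorem act_mem (hE : IsShiftInvariantPredual E) (a : L1) {x : Linf} (hx : x ∈ E) :
    act a x ∈ E :=
  tsum_mem hE.isClosed fun k => E.smul_mem _ (hE.shiftBy_mem k hx)

end IsShiftInvariantPredual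


namespace IsShiftInvariantPredual

variable {E : Submodule ℂ Linf} (hE : IsShiftInvariantPredual E)

/-! ### Convolution on the dual of a shift-invariant predual -/

/-- The identification of `ℓ₁(ℤ)` with `E*` given by a shift-invariant predual `E`. -/
def dualEquiv : L1 ≃L[ℂ] StrongDual ℂ E := hE.isInvertible.choose

theorem dualEquiv_apply (a : L1) (x : E) : hE.dualEquiv a x = pairing x a := by
  have h : (hE.dualEquiv : L1 →L[ℂ] StrongDual ℂ E) = iota E := hE.isInvertible.choose_spec
  exact DFunLike.congr_fun (DFunLike.congr_fun h a) x

/-- The element of `ℓ₁(ℤ)` represented by a functional on `E`. -/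
def toL1 (φ : WeakDual ℂ E) : L1 := hE.dualEquiv.symm (WeakDual.toStrongDual φ)

/-- The functional on `E` represented by an element of `ℓ₁(ℤ)`. -/
def ofL1 (a : L1) : WeakDual ℂ E := StrongDual.toWeakDual (hE.dualEquiv a)

theorem toL1_ofL1 (a : L1) : hE.toL1 (hE.ofL1 a) = a := hE.dualEquiv.symm_apply_apply a

theorem ofL1_toL1 (φ : WeakDual ℂ E) : hE.ofL1 (hE.toL1 φ) = φ := hE.dualEquiv.apply_symm_apply _

theorem ofL1_apply (a : L1) (x : E) : hE.ofL1 a x = pairing x a := hE.dualEquiv_apply a x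

theorem pairing_toL1 (φ : WeakDual ℂ E) (x : E) : pairing x (hE.toL1 φ) = φ x := by
  rw [← ofL1_apply hE, ofL1_toL1]

theorem toL1_injective : Function.Injective hE.toL1 :=
  Function.LeftInverse.injective hE.ofL1_toL1

/-- Convolution, transported from `ℓ₁(ℤ)` to `E*`. -/
def dualConv (φ ψ : WeakDual ℂ E) : WeakDual ℂ E := hE.ofL1 (l1Conv (hE.toL1 φ) (hE.toL1 ψ))

theorem toL1_dualConv (φ ψ : WeakDual ℂ E) :
    hE.toL1 (hE.dualConv φ ψ) = l1Conv (hE.toL1 φ) (hE.toL1 ψ) := hE.toL1_ofL1 _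

theorem dualConv_comm (φ ψ : WeakDual ℂ E) : hE.dualConv φ ψ = hE.dualConv ψ φ := by
  rw [dualConv, l1Conv_comm, dualConv]

/-- The action of `ℓ₁(ℤ)` on `E`. -/
def actMem (a : L1) (x : E) : E := ⟨act a x, hE.act_mem a x.2⟩

/-- For fixed φ and x, the right side is evaluation of ψ at one element of E. This is what makes the
product weak*-continuous in ψ, and by commutativity in φ. -/
theorem dualConv_apply (φ ψ : WeakDual ℂ E) (x : E) :
    hE.dualConv φ ψ x = ψ (hE.actMem (hE.toL1 φ) x) := by
  rw [dualConv, ofL1_apply, pairing_l1Conv, ← hE.pairing_toL1 ψ]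
  rfl

theorem continuous_dualConv_left (φ : WeakDual ℂ E) : Continuous fun ψ => hE.dualConv φ ψ := by
  refine WeakDual.continuous_of_continuous_eval fun x => ?_
  simp only [dualConv_apply]
  exact WeakDual.eval_continuous _

theorem continuous_dualConv_right (ψ : WeakDual ℂ E) : Continuous fun φ => hE.dualConv φ ψ := by
  simp only [dualConv_comm hE _ ψ]
  exact hE.continuous_dualConv_left ψ

/-- The point masses, as functionals on `E`. -/
def point (n : ℤ) : WeakDual ℂ E := hE.ofL1 (unit n)

theorem point_apply (n : ℤ) (x : E) : hE.point n x = (x : Linf) n := by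
  rw [point, ofL1_apply, pairing_unit]

theorem dualConv_point_point (m n : ℤ) :
    hE.dualConv (hE.point m) (hE.point n) = hE.point (m + n) := by
  rw [dualConv, point, point, toL1_ofL1, toL1_ofL1, l1Conv_unit_unit, point]

theorem point_injective : Function.Injective hE.point := fun m n h => by
  have h1 := congrArg hE.toL1 h
  rw [point, point, toL1_ofL1, toL1_ofL1] at h1
  exact unit_injective h1

/-! ### The compactification -/

/-- The weak*-closure of the set of point masses. -/
def hull : Set (WeakDual ℂ E) := closure (Set.range hE.point)

theorem point_mem_hull (n : ℤ) : hE.point n ∈ hE.hull := subset_closure ⟨n, rfl⟩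

/-- The bound holds at point masses and is a weak*-closed condition. It places the hull in the unit
ball of E*, so Banach–Alaoglu applies. -/
theorem norm_apply_le_of_mem_hull {φ : WeakDual ℂ E} (hφ : φ ∈ hE.hull) (x : E) :
    ‖φ x‖ ≤ ‖x‖ := by
  refine closure_minimal (t := {φ : WeakDual ℂ E | ‖φ x‖ ≤ ‖x‖}) ?_
    (isClosed_le (WeakDual.eval_continuous x).norm continuous_const) hφ
  rintro _ ⟨n, rfl⟩
  change ‖hE.point n x‖ ≤ ‖x‖
  rw [point_apply]
  exact lp.norm_apply_le_norm (by simp) (x : Linf) n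

theorem isCompact_hull : IsCompact hE.hull := by
  refine (WeakDual.isCompact_closedBall (𝕜 := ℂ) (0 : StrongDual ℂ E) 1).of_isClosed_subset
    isClosed_closure fun φ hφ => ?_
  refine (mem_closedBall_zero_iff (E := StrongDual ℂ E)).2 ?_
  refine ContinuousLinearMap.opNorm_le_bound _ zero_le_one fun x => ?_
  rw [one_mul]
  exact hE.norm_apply_le_of_mem_hull hφ x

/-- Separate continuity suffices when the limits are taken one at a time: first in the right factor
with an integer on the left, then in the left factor. -/
theorem dualConv_mem_hull {φ ψ : WeakDual ℂ E} (hφ : φ ∈ hE.hull) (hψ : ψ ∈ hE.hull) :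
    hE.dualConv φ ψ ∈ hE.hull := by
  have h1 : ∀ n, hE.dualConv (hE.point n) ψ ∈ hE.hull := fun n => by
    refine map_mem_closure (hE.continuous_dualConv_left (hE.point n)) hψ ?_
    rintro _ ⟨m, rfl⟩
    rw [dualConv_point_point]
    exact ⟨n + m, rfl⟩
  have h2 := map_mem_closure (t := hE.hull) (hE.continuous_dualConv_right ψ) hφ (by
    rintro _ ⟨n, rfl⟩
    exact h1 n)
  rwa [hull, closure_closure] at h2

/-- Convolution of elements of the hull. -/
@[reducible]
def hullSemigroup : AddSemigroup hE.hull where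
  add s t := ⟨hE.dualConv s t, hE.dualConv_mem_hull s.2 t.2⟩
  -- Associativity is inherited from ℓ₁(ℤ) through the injective map `toL1`.
  add_assoc s t u := Subtype.ext <| hE.toL1_injective <| by
    change hE.toL1 (hE.dualConv (hE.dualConv s t) u) = hE.toL1 (hE.dualConv s (hE.dualConv t u))
    simp only [toL1_dualConv, l1Conv_assoc]

/-- The semigroup compactification of `ℤ` defined by a shift-invariant predual: the weak*-closure
of the point masses, with convolution. -/
def compactification : SemigroupCompactification.{0} :=
  letI := hE.hullSemigroup
  { carrier := hE.hull
    compactSpace := isCompact_iff_compactSpace.1 hE.isCompact_hull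
    separatelyContinuousAdd :=
      { continuous_const_add := fun {s} =>
          ((hE.continuous_dualConv_left s).comp continuous_subtype_val).subtype_mk _
        continuous_add_const := fun {s} =>
          ((hE.continuous_dualConv_right s).comp continuous_subtype_val).subtype_mk _ }
    emb :=
      { toFun := fun n => ⟨hE.point n, hE.point_mem_hull n⟩
        map_add' := fun m n => Subtype.ext (hE.dualConv_point_point m n).symm }
    emb_injective := fun m n h => hE.point_injective (congrArg Subtype.val h)
    emb_denseRange := by
      rw [DenseRange, Subtype.dense_iff, ← Set.range_comp]
      exact subset_rfl }

/-- The inclusion of the compactification into `E*`. -/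
def toDual (s : hE.compactification.carrier) : WeakDual ℂ E := Subtype.val (p := (· ∈ hE.hull)) s

theorem toDual_mem (s : hE.compactification.carrier) : hE.toDual s ∈ hE.hull :=
  Subtype.prop (p := (· ∈ hE.hull)) s

theorem toDual_injective : Function.Injective hE.toDual := Subtype.val_injective

theorem continuous_toDual : Continuous hE.toDual := continuous_subtype_val

theorem toDual_emb (n : ℤ) : hE.toDual (hE.compactification.emb n) = hE.point n := rfl

theorem toDual_add (s t : hE.compactification.carrier) :
    hE.toDual (s + t) = hE.dualConv (hE.toDual s) (hE.toDual t) := rfl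

/-! ### The projection -/

/-- Elements of `E`, as continuous functions on the compactification. -/
def evaluation : E →L[ℂ] C(hE.compactification.carrier, ℂ) :=
  LinearMap.mkContinuous
    { toFun := fun x => ⟨fun s => hE.toDual s x,
        (WeakDual.eval_continuous x).comp hE.continuous_toDual⟩
      map_add' := fun x y => ContinuousMap.ext fun s => map_add (hE.toDual s) x y
      map_smul' := fun c x => ContinuousMap.ext fun s => map_smul (hE.toDual s) c x }
    1 (fun x => by
      rw [one_mul]
      exact (ContinuousMap.norm_le _ (norm_nonneg x)).2 fun s =>
        hE.norm_apply_le_of_mem_hull (hE.toDual_mem s) x)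

theorem evaluation_apply (x : E) (s : hE.compactification.carrier) :
    hE.evaluation x s = hE.toDual s x := rfl

theorem restrict_evaluation (x : E) : hE.compactification.restrict (hE.evaluation x) = x := by
  ext n
  change hE.evaluation x (hE.compactification.emb n) = _
  rw [evaluation_apply, toDual_emb, point_apply]

/-- The projection of `M(S)` onto `ℓ₁(ℤ)` dual to the inclusion of `E` in `C(S)`. -/
def projection : M hE.compactification.carrier →L[ℂ] L1 :=
  (hE.dualEquiv.symm : StrongDual ℂ E →L[ℂ] L1).comp
    (ContinuousLinearMap.precomp ℂ hE.evaluation)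

theorem projection_eq_toL1 (Φ : M hE.compactification.carrier) :
    hE.projection Φ = hE.toL1 (StrongDual.toWeakDual (Φ.comp hE.evaluation)) := rfl

theorem pairing_projection (Φ : M hE.compactification.carrier) (x : E) :
    pairing x (hE.projection Φ) = Φ (hE.evaluation x) := by
  rw [projection_eq_toL1, pairing_toL1]
  rfl

/-- Injectivity of ι_E: the predual separates points of ℓ₁(ℤ). -/
theorem eq_of_pairing_eq_on (hE : IsShiftInvariantPredual E) {a b : L1} (h : ∀ x : E, pairing x a = pairing x b) : a = b := by
  rw [← hE.toL1_ofL1 a, ← hE.toL1_ofL1 b]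
  congr 1
  refine DFunLike.ext _ _ fun x => ?_
  rw [ofL1_apply, ofL1_apply, h]

/-- Exhibits the kernel as the annihilator of the copy of E in C(S), hence as an intersection of
weak*-closed hyperplanes or the whole space. -/
theorem projection_eq_zero_iff (Φ : M hE.compactification.carrier) :
    hE.projection Φ = 0 ↔ ∀ x, Φ (hE.evaluation x) = 0 := by
  constructor
  · intro h x
    rw [← pairing_projection, h, map_zero]
  · intro h
    refine hE.eq_of_pairing_eq_on fun x => ?_
    rw [pairing_projection, h, map_zero]

theorem projection_dirac (s : hE.compactification.carrier) :
    hE.projection (dirac s) = hE.toL1 (hE.toDual s) := by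
  refine hE.eq_of_pairing_eq_on fun x => ?_
  rw [pairing_projection, pairing_toL1]
  rfl

theorem projection_incl (a : L1) : hE.projection (hE.compactification.incl a) = a := by
  refine hE.eq_of_pairing_eq_on fun x => ?_
  rw [pairing_projection]
  change pairing (hE.compactification.restrict (hE.evaluation x)) a = _
  rw [restrict_evaluation]

theorem evaluation_add (x : E) (s t : hE.compactification.carrier) :
    hE.evaluation x (s + t) = hE.evaluation (hE.actMem (hE.toL1 (hE.toDual t)) x) s := by
  rw [evaluation_apply, toDual_add, dualConv_comm, dualConv_apply, evaluation_apply]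

/-- Translates of functions from E come from E, so Φ sees them only through ΘΦ. At t, the two sides
pair x with the convolution of ΘΦ and t taken in opposite orders. -/
theorem innerIntegral_evaluation (Φ : M hE.compactification.carrier) (x : E) :
    innerIntegral Φ (hE.evaluation x) = hE.evaluation (hE.actMem (hE.projection Φ) x) := by
  ext t
  have h : translate t (hE.evaluation x) =
      hE.evaluation (hE.actMem (hE.toL1 (hE.toDual t)) x) :=
    ContinuousMap.ext fun s => hE.evaluation_add x s t
  change Φ (translate t (hE.evaluation x)) = _
  rw [h, ← pairing_projection, evaluation_apply, ← hE.pairing_toL1]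
  change pairing (act _ _) _ = pairing (act _ _) _
  rw [← pairing_l1Conv, ← pairing_l1Conv, l1Conv_comm]

theorem projection_conv (Φ Ψ : M hE.compactification.carrier) :
    hE.projection (conv Φ Ψ) = l1Conv (hE.projection Φ) (hE.projection Ψ) := by
  refine hE.eq_of_pairing_eq_on fun x => ?_
  rw [pairing_projection, conv_apply, innerIntegral_evaluation, ← pairing_projection,
    pairing_l1Conv]
  rfl

theorem isAdmissible_projection : hE.compactification.IsAdmissible hE.projection where
  projection := hE.projection_incl
  map_conv := hE.projection_conv
  ker_weakStar_closed := by
    have : {Φ : WeakDual ℂ C(hE.compactification.carrier, ℂ) |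
        hE.projection (WeakDual.toStrongDual Φ) = 0} = ⋂ x, {Φ | Φ (hE.evaluation x) = 0} := by
      ext Φ
      rw [Set.mem_ofPred_eq, projection_eq_zero_iff, Set.mem_iInter]
      rfl
    rw [this]
    exact isClosed_iInter fun x => isClosed_eq (WeakDual.eval_continuous _) continuous_const

theorem projection_dirac_injective :
    Function.Injective fun s : hE.compactification.carrier => hE.projection (dirac s) := by
  simp only [projection_dirac]
  exact hE.toL1_injective.comp hE.toDual_injective

/-! ### Recovering E as the preannihilator -/

theorem isClosed_range_evaluation : IsClosed (LinearMap.range hE.evaluation.toLinearMap : Set C(hE.compactification.carrier, ℂ)) := by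
  have : (LinearMap.range hE.evaluation.toLinearMap : Set C(hE.compactification.carrier, ℂ)) =
      hE.compactification.restrict ⁻¹' (E : Set Linf) := by
    ext f
    constructor
    · rintro ⟨x, rfl⟩
      change hE.compactification.restrict (hE.evaluation x) ∈ E
      rw [restrict_evaluation]
      exact x.2
    · intro hf
      -- A continuous function on S is determined by its values on ℤ, so it equals the evaluation
      -- function of its restriction.
      exact ⟨⟨_, hf⟩, hE.compactification.isometry_restrict.injective (hE.restrict_evaluation _)⟩
  rw [this]
  exact hE.isClosed.preimage hE.compactification.restrict.continuous

/-- The bipolar theorem on the C(S) side: the image of E is norm closed, so a function outside it is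
detected by a measure annihilating E, which lies in the kernel. -/
theorem preannihilator_projection :
    hE.compactification.preannihilator hE.projection =
      LinearMap.range hE.evaluation.toLinearMap := by
  ext f
  constructor
  · intro hf
    by_contra hne
    obtain ⟨Ψ, hΨ, hΨf⟩ := exists_dual_separating _ hE.isClosed_range_evaluation hne
    exact hΨf (hf Ψ ((hE.projection_eq_zero_iff Ψ).2 fun x => hΨ _ ⟨x, rfl⟩))
  · rintro ⟨x, rfl⟩ Ψ hΨ
    exact (hE.projection_eq_zero_iff Ψ).1 hΨ x

theorem eq_inducedSubspace : E = hE.compactification.inducedSubspace hE.projection := by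
  ext x
  rw [SemigroupCompactification.mem_inducedSubspace, preannihilator_projection]
  constructor
  · intro hx
    exact ⟨_, ⟨⟨x, hx⟩, rfl⟩, hE.restrict_evaluation ⟨x, hx⟩⟩
  · rintro ⟨_, ⟨y, rfl⟩, rfl⟩
    change hE.compactification.restrict (hE.evaluation y) ∈ E
    rw [restrict_evaluation]
    exact y.2

end IsShiftInvariantPredual

end ShiftPredual

end

theorem theorem4p1 :
    (∀ (S : ShiftPredual.SemigroupCompactification.{u})
        (Θ : ShiftPredual.M S.carrier →L[ℂ] ShiftPredual.L1),
      S.IsAdmissible Θ → ShiftPredual.IsShiftInvariantPredual (S.inducedSubspace Θ)) ∧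
    (∀ E : Submodule ℂ ShiftPredual.Linf, ShiftPredual.IsShiftInvariantPredual E →
      ∃ (S : ShiftPredual.SemigroupCompactification.{0})
        (Θ : ShiftPredual.M S.carrier →L[ℂ] ShiftPredual.L1),
        S.IsAdmissible Θ ∧ E = S.inducedSubspace Θ ∧
          Function.Injective fun s : S.carrier => Θ (ShiftPredual.dirac s)) := by
  refine ⟨fun S Θ hΘ => hΘ.isShiftInvariantPredual, fun E hE => ?_⟩
  exact ⟨hE.compactification, hE.projection, hE.isAdmissible_projection, hE.eq_inducedSubspace,
    hE.projection_dirac_injective⟩
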